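/- Let a Lie group $G$ act smoothly on a Riemannian manifold $X$ (Hausdorff, second countable), and suppose that the Riemannian measure of $X$ is $G$-invariant. Let $Y$ be a closed (embedded) submanifold of $X$ with the induced Riemannian metric, and let $X_z\subset X$, $Y_z\subset Y$ be closed subsets of measure zero for the Riemannian measures of $X$ and $Y$ respectively. Put $X'=X\setminus X_z$, $Y'=Y\setminus Y_z$, $$K=\{g\in G: g\cdot y=y\ \ \forall y\in Y\},\qquad N=\{g\in G: g\cdot Y=Y\},\qquad N_y=\{g\in G: g\cdot y\in Y\}\quad (y\in Y).$$ For $y\in X$ let $O_y$ be the orbit and $G_y$ the stabilizer of $y$. Suppose that (a) $X'=\bigcup_{y\in Y'}O_y$; (b) $T_yX=T_yO_y\oplus T_yY$ for every $y\in Y'$; (c) $\dim G_y=\dim K$ for every $y\in Y'$. Suppose also that $N/K$ is a finite group of order $d$, that $N_y=N$ for every $y\in Y'$, and that $g\cdot y\in Y'$ for all $g\in N$ and $y\in Y'$. Then the map $$\varphi: G/K\times Y'\to X',\qquad \varphi([g],y)=g\cdot y,$$ is a $d$-sheeted covering map, that is, a covering map all of whose fibres have exactly $d$ points. -/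

import Mathlib

open scoped Manifold ContDiff Pointwise
open MeasureTheory

namespace WeylCovering

/-- A bilinear form on each tangent space of a manifold (the values of a metric). -/
abbrev TangentForm (n : ℕ) (M : Type*) [TopologicalSpace M]
    [ChartedSpace (EuclideanSpace ℝ (Fin n)) M] :=
  ∀ p : M, TangentSpace (𝓡 n) p → TangentSpace (𝓡 n) p → ℝ

section RiemannianMeasure

variable {n : ℕ} {M : Type*} [TopologicalSpace M] [ChartedSpace (EuclideanSpace ℝ (Fin n)) M]

/-- The coordinate vector field `∂ᵢ` of the chart `e`, at the point with coordinates `u`. -/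
noncomputable def coordVec (e : OpenPartialHomeomorph M (EuclideanSpace ℝ (Fin n)))
    (u : EuclideanSpace ℝ (Fin n)) (i : Fin n) : TangentSpace (𝓡 n) (e.symm u) :=
  mfderiv (𝓡 n) (𝓡 n) e.symm u (EuclideanSpace.single i (1 : ℝ))

/-- The density `√ det (g(∂ᵢ, ∂ⱼ))` of the metric `g` in the chart `e`. -/
noncomputable def chartDensity (g : TangentForm n M)
    (e : OpenPartialHomeomorph M (EuclideanSpace ℝ (Fin n)))
    (u : EuclideanSpace ℝ (Fin n)) : ℝ :=
  Real.sqrt (Matrix.of fun i j : Fin n =>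
    g (e.symm u) (coordVec e u i) (coordVec e u j)).det

/-- The measure `√ det (gᵢⱼ) du₁ ⋯ duₙ` of the chart domain of `e`, as a measure on `M` that
vanishes outside that domain. -/
noncomputable def chartMeasure [MeasurableSpace M] (g : TangentForm n M)
    (e : OpenPartialHomeomorph M (EuclideanSpace ℝ (Fin n))) : Measure M :=
  Measure.map e.symm
    ((volume.restrict e.target).withDensity fun u => ENNReal.ofReal (chartDensity g e u))

/-- The Riemannian measure of `g`. The measures of the chart domains agree on overlaps, so on a
second countable manifold their supremum is the unique measure that restricts to
`√ det (gᵢⱼ) du₁ ⋯ duₙ` on each chart domain. -/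
noncomputable def riemannianMeasure [MeasurableSpace M] (g : TangentForm n M) : Measure M :=
  ⨆ p : M, chartMeasure g (chartAt (EuclideanSpace ℝ (Fin n)) p)

end RiemannianMeasure

/-- The form underlying a Riemannian metric. -/
noncomputable def metricForm {n : ℕ} {X : Type*} [TopologicalSpace X]
    [ChartedSpace (EuclideanSpace ℝ (Fin n)) X] [IsManifold (𝓡 n) ∞ X]
    (g : Bundle.ContMDiffRiemannianMetric (𝓡 n) ∞ (EuclideanSpace ℝ (Fin n))
      (fun x : X => TangentSpace (𝓡 n) x)) : TangentForm n X :=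
  fun x v w => g.inner x v w

/-- The form `ι^* g` induced on a submanifold `ι : Y → X`. -/
noncomputable def inducedForm {n m : ℕ} {X Y : Type*} [TopologicalSpace X]
    [ChartedSpace (EuclideanSpace ℝ (Fin n)) X]
    [TopologicalSpace Y] [ChartedSpace (EuclideanSpace ℝ (Fin m)) Y]
    (g : TangentForm n X) (ι : Y → X) : TangentForm m Y :=
  fun y v w => g (ι y) (mfderiv (𝓡 m) (𝓡 n) ι y v) (mfderiv (𝓡 m) (𝓡 n) ι y w)

section LieGroup

variable {E : Type*} [NormedAddCommGroup E] [NormedSpace ℝ E]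
  {G : Type*} [TopologicalSpace G] [ChartedSpace E G] [Group G]

/-- The Lie algebra of a closed subgroup `H` of a Lie group `G`, as a subspace of `T₁G`: the
velocities at `0` of the one-parameter subgroups of `G` that stay in `H`. (For closed `H` these
velocities already form a subspace, so that the span adds nothing.) -/
noncomputable def lieAlgebraOf (H : Subgroup G) :
    Submodule ℝ (TangentSpace 𝓘(ℝ, E) (1 : G)) :=
  Submodule.span ℝ {v : E | ∃ γ : ℝ → G, ContMDiff 𝓘(ℝ, ℝ) 𝓘(ℝ, E) ∞ γ ∧
    (∀ s t, γ (s + t) = γ s * γ t) ∧ (∀ t, γ t ∈ H) ∧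
    (mfderiv 𝓘(ℝ, ℝ) 𝓘(ℝ, E) γ 0 (1 : ℝ) : E) = v}

/-- The dimension of a closed subgroup of a Lie group. -/
noncomputable def lieDim (E : Type*) [NormedAddCommGroup E] [NormedSpace ℝ E]
    {G : Type*} [TopologicalSpace G] [ChartedSpace E G] [Group G] (H : Subgroup G) : ℕ :=
  Module.finrank ℝ (lieAlgebraOf (E := E) H)

end LieGroup

/-- The tangent space at `x` of the orbit of `x`, an immersed submanifold of `X`: the range of the
differential at `1` of the orbit map `g ↦ g • x`. -/
noncomputable def orbitTangent (E : Type*) [NormedAddCommGroup E] [NormedSpace ℝ E]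
    (G : Type*) [TopologicalSpace G] [ChartedSpace E G] [Group G]
    {n : ℕ} {X : Type*} [TopologicalSpace X] [ChartedSpace (EuclideanSpace ℝ (Fin n)) X]
    [MulAction G X] (x : X) : Submodule ℝ (TangentSpace (𝓡 n) x) :=
  LinearMap.range (mfderiv 𝓘(ℝ, E) (𝓡 n) (fun g : G => g • x) 1).toLinearMap

/-- The tangent space at `y` of a submanifold `ι : Y → X`, as a subspace of `T_{ι y} X`. -/
noncomputable def submanifoldTangent {n m : ℕ} {X Y : Type*} [TopologicalSpace X]
    [ChartedSpace (EuclideanSpace ℝ (Fin n)) X]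
    [TopologicalSpace Y] [ChartedSpace (EuclideanSpace ℝ (Fin m)) Y]
    (ι : Y → X) (y : Y) : Submodule ℝ (TangentSpace (𝓡 n) (ι y)) :=
  LinearMap.range (mfderiv (𝓡 m) (𝓡 n) ι y).toLinearMap

section Action

variable (G : Type*) [Group G] {X Y : Type*} [MulAction G X] (ι : Y → X)

/-- `K`, the pointwise stabilizer of the submanifold `ι : Y → X`. -/
abbrev pointStab : Subgroup G := fixingSubgroup G (Set.range ι)

/-- `N = {g | g • Y = Y}`, the setwise stabilizer of the submanifold `ι : Y → X`. -/
abbrev setStab : Subgroup G := MulAction.stabilizer G (Set.range ι)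

/-- `N_y = {g | g • y ∈ Y}`. -/
def transporter (y : Y) : Set G := {g | g • ι y ∈ Set.range ι}

/-- The map `φ : G/K × Y → X`, `([g], y) ↦ g • y`. -/
def phi (p : (G ⧸ pointStab G ι) × Y) : X :=
  Quotient.liftOn' p.1 (fun g : G => g • ι p.2) (by
    intro a b hab
    have h := (mem_fixingSubgroup_iff G).1 (QuotientGroup.leftRel_apply.1 hab) (ι p.2) ⟨p.2, rfl⟩
    rw [mul_smul, inv_smul_eq_iff] at h
    exact h.symm)

theorem phi_mk (g : G) (y : Y) : phi G ι ((g : G ⧸ pointStab G ι), y) = g • ι y := rfl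

/-- The invariance condition `X' = ⋃_{y ∈ Y'} G • y`. -/
def Invariance (X' : Set X) (Y' : Set Y) : Prop :=
  X' = ⋃ y ∈ Y', MulAction.orbit G (ι y)

/-- The map `φ : G/K × Y' → X'`, `([g], y) ↦ g • y`. -/
def phiRes {X' : Set X} {Y' : Set Y} (h : Invariance G ι X' Y') :
    (G ⧸ pointStab G ι) × Y' → X' :=
  fun p => ⟨phi G ι (p.1, p.2), by
    obtain ⟨q, y, hy⟩ := p
    induction q using QuotientGroup.induction_on with
    | H g =>
      rw [h]
      exact Set.mem_biUnion hy ⟨g, rfl⟩⟩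

end Action

/-- A `d`-sheeted covering map: a covering map all of whose fibres have exactly `d` points
(for `d ≥ 1`, as `Nat.card` of an infinite type is `0`). -/
def IsSheetedCovering {A B : Type*} [TopologicalSpace A] [TopologicalSpace B]
    (d : ℕ) (f : A → B) : Prop :=
  0 < d ∧ IsCoveringMap f ∧ ∀ b : B, Nat.card (f ⁻¹' {b}) = d

end WeylCovering

open scoped Topology
open Set Filter

section Covering

/-! The map `φ` is continuous and open, its source is Hausdorff, and all its fibres have `d` points;
these properties alone force a covering (`IsOpenMap.isCoveringMap_of_card_fiber_eq`). Fibres: if `h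
• y₀ = x`, the points over `x` are `([h n], n⁻¹ • y₀)` with `n` running over `N/K`
(`card_fiber_phiRes`). Openness: by transversality `(g, y) ↦ g • y` on `G × Y` has onto differential
at `(1, y)`, hence is open there (`map_smul_nhds_one`). Equivariance carries this to every `(g, y)`,
and it descends to `G/K`, where no smooth structure is needed. -/

/-- A continuous open map with Hausdorff source all of whose fibres have the same finite number of
points is a covering map. -/
theorem IsOpenMap.isCoveringMap_of_card_fiber_eq {A B : Type*} [TopologicalSpace A]
    [TopologicalSpace B] [T2Space A] {f : A → B} (hopen : IsOpenMap f) (hf : Continuous f) {d : ℕ}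
    (hd : 0 < d) (hcard : ∀ b, Nat.card (f ⁻¹' {b}) = d) : IsCoveringMap f := by
  intro x
  have hfin (b : B) : Finite (f ⁻¹' {b}) := Nat.finite_of_card_ne_zero (by rw [hcard]; omega)
  have hne : Nonempty (f ⁻¹' {x}) := (Nat.card_pos_iff.1 (by rw [hcard]; omega)).1
  have hdisc : DiscreteTopology (f ⁻¹' {x}) := inferInstance
  obtain ⟨V, hV, disj⟩ := (toFinite (f ⁻¹' {x})).t2_separation
  let U : Set B := ⋂ e : f ⁻¹' {x}, f '' V e
  have hU : IsOpen U := isOpen_iInter_of_finite fun e => hopen _ (hV e).2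
  have hxU : x ∈ U := mem_iInter.2 fun e => ⟨e, (hV e).1, e.2⟩
  -- over `U`, each point of a fibre lies in exactly one `V e`, and each `V e` has one such point
  have key : ∀ b ∈ U, ∃ s : f ⁻¹' {x} → f ⁻¹' {b}, Function.Surjective s ∧
      ∀ e : f ⁻¹' {x}, (s e : A) ∈ V e := by
    intro b hb
    choose s hs hsb using mem_iInter.1 hb
    refine ⟨fun e => ⟨s e, hsb e⟩, ?_, hs⟩
    -- Disjointness of the `V e` gives injectivity; equality of the fibre cardinalities upgrades it
    -- to surjectivity.
    refine ((Nat.bijective_iff_injective_and_card _).2 ⟨fun e e' hee => ?_, ?_⟩).2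
    · by_contra hne'
      have h1 : s e = s e' := congrArg Subtype.val hee
      exact (disj e.2 e'.2 fun h => hne' (Subtype.ext h)).le_bot ⟨hs e, h1 ▸ hs e'⟩
    · rw [hcard, hcard]
  have hunique : ∀ e : f ⁻¹' {x}, ∀ a ∈ V e, ∀ a' ∈ V e, f a ∈ U → f a = f a' → a = a' := by
    intro e a ha a' ha' haU haa
    obtain ⟨s, hs, hsV⟩ := key _ haU
    have hval : ∀ c : f ⁻¹' {f a}, (c : A) ∈ V e → c = s e := by
      intro c hc
      obtain ⟨e', rfl⟩ := hs c
      by_contra hne'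
      exact (disj e'.2 e.2 fun h => hne' (congrArg s (Subtype.ext h))).le_bot ⟨hsV e', hc⟩
    have h1 := hval ⟨a, rfl⟩ ha
    have h2 := hval ⟨a', haa.symm⟩ ha'
    exact congrArg Subtype.val (h1.trans h2.symm)
  have : Nonempty A := ⟨(Classical.arbitrary (f ⁻¹' {x}) : A)⟩
  refine (IsEvenlyCovered.of_trivialization (t := hU.trivializationDiscrete
    (fun e : f ⁻¹' {x} => V e ∩ f ⁻¹' U) U
    (fun e W hW => ⟨fun h => (h.preimage hf).inter ((hV e).2.inter (hU.preimage hf)), fun h => ?_⟩)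
    (fun e a ha a' ha' h => hunique e a ha.1 a' ha'.1 ha.2 h) (fun e b hb => ?_)
    (fun e e' hee => ?_) (fun a ha => ?_)) hxU).to_isEvenlyCovered_preimage
  -- A set `W ⊆ U` is the image of its preimage in `V e`, because `U ⊆ f '' V e`.
  · convert! hopen _ h using 1
    ext b
    constructor
    · intro hb
      obtain ⟨a, ha, rfl⟩ := mem_iInter.1 (hW hb) e
      exact ⟨a, ⟨hb, ha, hW hb⟩, rfl⟩
    · rintro ⟨a, ha, rfl⟩
      exact ha.1
  · obtain ⟨a, ha, rfl⟩ := mem_iInter.1 hb e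
    exact ⟨a, ⟨ha, hb⟩, rfl⟩
  · exact (disj e.2 e'.2 fun h => hee (Subtype.ext h)).mono inter_subset_left inter_subset_left
  · obtain ⟨s, hs, hsV⟩ := key _ ha
    obtain ⟨e, he⟩ := hs ⟨a, rfl⟩
    refine mem_iUnion.2 ⟨e, ?_, ha⟩
    have := hsV e
    rwa [he] at this

end Covering

/-! ### Submersions are open -/

section Submersion

/-- A `C¹` map between boundaryless manifolds whose differential at `x` is onto is open at `x`. -/
theorem ContMDiffAt.map_nhds_eq_of_surjective_mfderiv
    {E : Type*} [NormedAddCommGroup E] [NormedSpace ℝ E] [CompleteSpace E]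
    {H : Type*} [TopologicalSpace H] {I : ModelWithCorners ℝ E H} [I.Boundaryless]
    {M : Type*} [TopologicalSpace M] [ChartedSpace H M]
    {E' : Type*} [NormedAddCommGroup E'] [NormedSpace ℝ E'] [CompleteSpace E']
    {H' : Type*} [TopologicalSpace H'] {I' : ModelWithCorners ℝ E' H'} [I'.Boundaryless]
    {M' : Type*} [TopologicalSpace M'] [ChartedSpace H' M']
    {f : M → M'} {x : M} (hf : ContMDiffAt I I' 1 f x)
    (hsurj : Function.Surjective (mfderiv I I' f x)) : map f (𝓝 x) = 𝓝 (f x) := by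
  refine le_antisymm hf.continuousAt ?_
  have hg : ContDiffAt ℝ 1 (writtenInExtChartAt I I' x f) (extChartAt I x x) := by
    have := (contMDiffAt_iff.1 hf).2
    rwa [I.range_eq_univ, contDiffWithinAt_univ] at this
  have hstrict := hg.hasStrictFDerivAt one_ne_zero
  have hsurj' : Function.Surjective
      (fderiv ℝ (writtenInExtChartAt I I' x f) (extChartAt I x x)) := by
    rwa [(hf.mdifferentiableAt one_ne_zero).mfderiv, I.range_eq_univ, fderivWithin_univ] at hsurj
  -- Open mapping theorem for an onto strict derivative; what remains is to undo the charts.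
  have hmap := hstrict.map_nhds_eq_of_surj (LinearMap.range_eq_top.2 hsurj')
  have hx : writtenInExtChartAt I I' x f (extChartAt I x x) = extChartAt I' (f x) (f x) := by
    simp [writtenInExtChartAt]
  rw [hx, ← map_extChartAt_nhds_of_boundaryless, map_map] at hmap
  have hev : (extChartAt I' (f x)).symm ∘ (writtenInExtChartAt I I' x f ∘ extChartAt I x)
      =ᶠ[𝓝 x] f := by
    filter_upwards [extChartAt_source_mem_nhds (I := I) x,
      hf.continuousAt (extChartAt_source_mem_nhds (I := I') (f x))] with z hz hz'
    simp only [writtenInExtChartAt, Function.comp_apply]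
    rw [(extChartAt I x).left_inv hz, (extChartAt I' (f x)).left_inv hz']
  have hsymm := map_extChartAt_symm_nhdsWithin_range (I := I') (f x)
  rw [I'.range_eq_univ, nhdsWithin_univ, ← hmap, map_map,
    map_congr hev] at hsymm
  exact hsymm.ge

end Submersion

namespace WeylCovering

/-! ### Fibres, continuity and openness of the map -/

section Action

variable {G : Type*} [Group G] {X Y : Type*} [MulAction G X] {ι : Y → X}

/-- Each fibre of `φ : G/K × Y' → X'` is in bijection with `N/K`. -/
theorem card_fiber_phiRes (hι : Function.Injective ι) {X' : Set X} {Y' : Set Y}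
    (ha : Invariance G ι X' Y') (hNy : ∀ y ∈ Y', transporter G ι y = setStab G ι)
    (hNY : ∀ g ∈ setStab G ι, ∀ y ∈ Y', g • ι y ∈ ι '' Y') (x : X') :
    Nat.card (phiRes G ι ha ⁻¹' {x}) =
      Nat.card (setStab G ι ⧸ (pointStab G ι).subgroupOf (setStab G ι)) := by
  obtain ⟨x, hx⟩ := x
  obtain ⟨y₀, hy₀, h, hh⟩ : ∃ y₀ ∈ Y', ∃ h : G, h • ι y₀ = x := by
    have h := hx
    rw [ha] at h
    simpa [MulAction.mem_orbit_iff] using h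
  have hout (p : phiRes G ι ha ⁻¹' {⟨x, hx⟩}) : p.1.1.out • ι p.1.2 = x := by
    obtain ⟨⟨q, y⟩, hp⟩ := p
    refine Eq.trans ?_ (congrArg Subtype.val hp)
    change phi G ι ((q.out : G), (y : Y)) = phi G ι (q, y)
    rw [QuotientGroup.out_eq']
  have hmem (p : phiRes G ι ha ⁻¹' {⟨x, hx⟩}) : h⁻¹ * p.1.1.out ∈ setStab G ι := by
    have : h⁻¹ * p.1.1.out ∈ (setStab G ι : Set G) := by
      rw [← hNy _ p.1.2.2]
      -- If `g • y = x`, then `h⁻¹ g` sends `y` to `y₀ ∈ Y`, so it lies in `N_y = N`.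
      exact ⟨y₀, by rw [mul_smul, hout p, ← hh, inv_smul_smul]⟩
    exact this
  refine Nat.card_eq_of_bijective (fun p => QuotientGroup.mk ⟨h⁻¹ * p.1.1.out, hmem p⟩) ⟨?_, ?_⟩
  · intro p p' hpp
    have hK : p.1.1.out⁻¹ * p'.1.1.out ∈ pointStab G ι := by
      have := Subgroup.mem_subgroupOf.1 (QuotientGroup.eq.1 hpp)
      simpa [mul_assoc] using this
    have h1 : p.1.1 = p'.1.1 := by
      rw [← p.1.1.out_eq', ← p'.1.1.out_eq']
      exact QuotientGroup.eq.2 hK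
    have h2 : ι p.1.2 = ι p'.1.2 := by
      have e := (hout p).trans (hout p').symm
      rw [h1] at e
      exact smul_left_cancel _ e
    exact Subtype.ext (Prod.ext h1 (Subtype.ext (hι h2)))
  · intro q
    induction q using QuotientGroup.induction_on with
    | H n =>
      -- The preimage of `[n]` is `([h n], n⁻¹ • y₀)`.
      obtain ⟨y, hy, hyn⟩ := hNY _ (inv_mem n.2) y₀ hy₀
      refine ⟨⟨(((h * n : G) : G ⧸ pointStab G ι), ⟨y, hy⟩), Subtype.ext ?_⟩, ?_⟩
      · change (h * n : G) • ι y = x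
        rw [hyn, mul_smul, smul_inv_smul, hh]
      · obtain ⟨k, hk⟩ := QuotientGroup.mk_out_eq_mul (pointStab G ι) (h * n : G)
        refine (QuotientGroup.eq.2 (Subgroup.mem_subgroupOf.2 ?_)).symm
        change (n : G)⁻¹ * (h⁻¹ * (((h * n : G) : G ⧸ pointStab G ι)).out) ∈ pointStab G ι
        rw [hk]
        simp [mul_assoc]

variable [TopologicalSpace G] [IsTopologicalGroup G] [TopologicalSpace X] [ContinuousSMul G X]

/-- Lying in the same coset is a closed relation, cut out by fixed-point equations in the Hausdorff
space `X`, and the quotient map is open. -/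
theorem t2Space_quotient_fixingSubgroup [T2Space X] (s : Set X) :
    T2Space (G ⧸ fixingSubgroup G s) := by
  rw [t2Space_iff_of_isOpenQuotientMap QuotientGroup.isOpenQuotientMap_mk]
  have : {q : G × G | (q.1 : G ⧸ fixingSubgroup G s) = q.2} =
      ⋂ x ∈ s, {q : G × G | (q.1⁻¹ * q.2) • x = x} := by
    ext q
    simp [QuotientGroup.eq, mem_fixingSubgroup_iff]
  rw [this]
  exact isClosed_biInter fun x _ => isClosed_eq (by fun_prop) continuous_const

variable [TopologicalSpace Y]

theorem continuous_phiRes (hι : Continuous ι) {X' : Set X} {Y' : Set Y}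
    (ha : Invariance G ι X' Y') : Continuous (phiRes G ι ha) := by
  refine continuous_induced_rng.2 ?_
  -- Since `G → G/K` is open, its product with the identity of `Y'` is still a quotient map.
  rw [← (QuotientGroup.isOpenQuotientMap_mk.prodMap
    (IsOpenQuotientMap.id (X := Y'))).continuous_comp_iff]
  change Continuous fun p : G × Y' => p.1 • ι p.2
  fun_prop

/-- By equivariance, `(g, y) ↦ g • y` is open at `(g, y)` if it is open at `(1, y)`. -/
theorem nhds_le_map_smul {y : Y}
    (h : 𝓝 (ι y) ≤ map (fun p : G × Y => p.1 • ι p.2) (𝓝 (1, y))) (g : G) :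
    𝓝 (g • ι y) ≤ map (fun p : G × Y => p.1 • ι p.2) (𝓝 (g, y)) := by
  have h1 : map (fun x : X => g • x) (𝓝 (ι y)) = 𝓝 (g • ι y) :=
    (Homeomorph.smul g).map_nhds_eq (ι y)
  have h2 : map (Prod.map (fun a : G => g * a) (id : Y → Y)) (𝓝 (1, y)) = 𝓝 (g, y) := by
    simpa using ((Homeomorph.mulLeft g).prodCongr (Homeomorph.refl Y)).map_nhds_eq (1, y)
  rw [← h1, ← h2, map_map]
  refine (map_mono h).trans_eq ?_
  rw [map_map]
  congr 1
  ext p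
  simp [mul_smul]

theorem isOpenMap_phiRes {X' : Set X} {Y' : Set Y} (ha : Invariance G ι X' Y') (hX' : IsOpen X')
    (hY' : IsOpen Y')
    (h : ∀ y ∈ Y', 𝓝 (ι y) ≤ map (fun p : G × Y => p.1 • ι p.2) (𝓝 (1, y))) :
    IsOpenMap (phiRes G ι ha) := by
  rw [hX'.isOpenEmbedding_subtypeVal.isOpenMap_iff]
  have hq := QuotientGroup.isOpenQuotientMap_mk (N := pointStab G ι) |>.prodMap
    (IsOpenQuotientMap.id (X := Y'))
  refine IsOpenMap.of_comp hq.continuous hq.surjective ?_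
  change IsOpenMap ((fun p : G × Y => p.1 • ι p.2) ∘ Prod.map id ((↑) : Y' → Y))
  refine IsOpenMap.of_nhds_le fun p => ?_
  have h1 : map (Prod.map id ((↑) : Y' → Y)) (𝓝 p) = 𝓝 (p.1, (p.2 : Y)) :=
    (Topology.IsOpenEmbedding.id.prodMap hY'.isOpenEmbedding_subtypeVal).map_nhds_eq p
  rw [← map_map, h1]
  exact nhds_le_map_smul (h _ p.2.2) p.1

end Action

/-- If `X` is spanned at `y` by the tangent spaces of the orbit and of the submanifold, then
`(g, y) ↦ g • y` is open at `(1, y)`. -/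
theorem map_smul_nhds_one {E : Type*} [NormedAddCommGroup E] [NormedSpace ℝ E] [CompleteSpace E]
    {G : Type*} [TopologicalSpace G] [ChartedSpace E G] [Group G]
    {n : ℕ} {X : Type*} [TopologicalSpace X] [ChartedSpace (EuclideanSpace ℝ (Fin n)) X]
    [MulAction G X] [ContMDiffSMul 𝓘(ℝ, E) (𝓡 n) 1 G X]
    {m : ℕ} {Y : Type*} [TopologicalSpace Y] [ChartedSpace (EuclideanSpace ℝ (Fin m)) Y]
    {ι : Y → X} (hι : ContMDiff (𝓡 m) (𝓡 n) 1 ι) {y : Y}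
    (hb : orbitTangent E G (n := n) (ι y) ⊔ submanifoldTangent (n := n) (m := m) ι y = ⊤) :
    map (fun p : G × Y => p.1 • ι p.2) (𝓝 (1, y)) = 𝓝 (ι y) := by
  have hF : ContMDiff (𝓘(ℝ, E).prod (𝓡 m)) (𝓡 n) 1 (fun p : G × Y => p.1 • ι p.2) :=
    contMDiff_fst.smul (hι.comp contMDiff_snd)
  have := (hF (1, y)).map_nhds_eq_of_surjective_mfderiv ?_
  · simpa using this
  · intro v
    have hv : (show TangentSpace (𝓡 n) (ι y) from v) ∈ orbitTangent E G (n := n) (ι y) ⊔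
        submanifoldTangent (n := n) (m := m) ι y := hb ▸ Submodule.mem_top
    obtain ⟨_, ⟨a, rfl⟩, _, ⟨b, rfl⟩, hab⟩ := Submodule.mem_sup.1 hv
    -- The partial map in `Y` is `z ↦ 1 • ι z`; stating its derivative on the model spaces avoids a
    -- transport between tangent spaces at `1 • ι y` and `ι y`.
    have h1 := congrArg (β := EuclideanSpace ℝ (Fin m) →L[ℝ] EuclideanSpace ℝ (Fin n))
      (fun f : Y → X => mfderiv (𝓡 m) (𝓡 n) f y)
      (show (fun z : Y => (1 : G) • ι z) = ι by ext z; simp)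
    have h2 := mfderiv_prod_eq_add_comp ((hF (1, y)).mdifferentiableAt one_ne_zero)
    refine ⟨(a, b), ?_⟩
    rw [h2]
    exact (congrArg (mfderiv 𝓘(ℝ, E) (𝓡 n) (fun g : G => g • ι y) 1 a + ·)
      (DFunLike.congr_fun h1 b)).trans hab

end WeylCovering

theorem theorem1p1
    -- the Lie group `G`
    {E : Type*} [NormedAddCommGroup E] [NormedSpace ℝ E] [FiniteDimensional ℝ E]
    {G : Type*} [TopologicalSpace G] [ChartedSpace E G] [Group G] [LieGroup 𝓘(ℝ, E) ∞ G]
    -- the Riemannian manifold `X`, with its smooth `G`-action and `G`-invariant measure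
    {n : ℕ} {X : Type*} [TopologicalSpace X] [T2Space X] [SecondCountableTopology X]
    [ChartedSpace (EuclideanSpace ℝ (Fin n)) X] [IsManifold (𝓡 n) ∞ X]
    [MeasurableSpace X] [BorelSpace X]
    (met : Bundle.ContMDiffRiemannianMetric (𝓡 n) ∞ (EuclideanSpace ℝ (Fin n))
      (fun x : X => TangentSpace (𝓡 n) x))
    [MulAction G X] [ContMDiffSMul 𝓘(ℝ, E) (𝓡 n) ∞ G X]
    (hinv : SMulInvariantMeasure G X
      (WeylCovering.riemannianMeasure (WeylCovering.metricForm met)))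
    -- the closed submanifold `Y` of `X`, with inclusion `ι`
    {m : ℕ} {Y : Type*} [TopologicalSpace Y]
    [ChartedSpace (EuclideanSpace ℝ (Fin m)) Y] [IsManifold (𝓡 m) ∞ Y]
    [MeasurableSpace Y] [BorelSpace Y]
    (ι : Y → X) (hι : Manifold.IsSmoothEmbedding (𝓡 m) (𝓡 n) ∞ ι)
    (hιclosed : IsClosed (Set.range ι))
    -- the exceptional closed null sets; `X' = Xzᶜ` and `Y' = Yzᶜ`
    (Xz : Set X) (hXz : IsClosed Xz)
    (hXz0 : WeylCovering.riemannianMeasure (WeylCovering.metricForm met) Xz = 0)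
    (Yz : Set Y) (hYz : IsClosed Yz)
    (hYz0 : WeylCovering.riemannianMeasure
      (WeylCovering.inducedForm (m := m) (WeylCovering.metricForm met) ι) Yz = 0)
    -- (a) invariance
    (ha : WeylCovering.Invariance G ι Xzᶜ Yzᶜ)
    -- (b) transversality
    (hb : ∀ y ∈ Yzᶜ, IsCompl (WeylCovering.orbitTangent E G (n := n) (ι y))
      (WeylCovering.submanifoldTangent (n := n) (m := m) ι y))
    -- (c) dimension
    (hc : ∀ y ∈ Yzᶜ, WeylCovering.lieDim E (MulAction.stabilizer G (ι y)) =
      WeylCovering.lieDim E (WeylCovering.pointStab G ι))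
    -- `N / K` is finite of order `d`
    (d : ℕ) (hd : 0 < d)
    (hcard : Nat.card (WeylCovering.setStab G ι ⧸
      (WeylCovering.pointStab G ι).subgroupOf (WeylCovering.setStab G ι)) = d)
    -- `N_y = N` for `y ∈ Y'`
    (hNy : ∀ y ∈ Yzᶜ, WeylCovering.transporter G ι y = WeylCovering.setStab G ι)
    -- `N` preserves `Y'`
    (hNY : ∀ g ∈ WeylCovering.setStab G ι, ∀ y ∈ Yzᶜ, g • ι y ∈ ι '' Yzᶜ) :
    WeylCovering.IsSheetedCovering d (WeylCovering.phiRes G ι ha) := by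
  have := topologicalGroup_of_lieGroup 𝓘(ℝ, E) ∞ (G := G)
  have := ContMDiffSMul.continuousSMul (I := 𝓘(ℝ, E)) (I' := 𝓡 n) (G := G) (M := X) ∞
  have : ContMDiffSMul 𝓘(ℝ, E) (𝓡 n) 1 G X := inferInstance
  have := FiniteDimensional.complete ℝ E
  have := hι.isEmbedding.t2Space
  have := WeylCovering.t2Space_quotient_fixingSubgroup (G := G) (Set.range ι)
  have hfib (x) := (WeylCovering.card_fiber_phiRes hι.isEmbedding.injective ha hNy hNY x).trans hcard
  refine ⟨hd, IsOpenMap.isCoveringMap_of_card_fiber_eq ?_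
    (WeylCovering.continuous_phiRes hι.isEmbedding.continuous ha) hd hfib, hfib⟩
  exact WeylCovering.isOpenMap_phiRes ha hXz.isOpen_compl hYz.isOpen_compl fun y hy =>
    (WeylCovering.map_smul_nhds_one (hι.contMDiff.of_le (by norm_num)) (hb y hy).sup_eq_top).ge
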